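/- All graphs are finite, simple and undirected. A \emph{subdivided star} is a tree with exactly one vertex of degree at least $3$. A graph is \emph{$F$-subgraph-free} if it has no (not necessarily induced) subgraph isomorphic to $F$. An \emph{elimination forest} of a graph $G$ is a rooted forest $T$ with $V(T)=V(G)$ such that for every edge $uv$ of $G$ both $u$ and $v$ lie on a common root-to-leaf path of $T$; the \emph{treedepth} of $G$ is the minimum height of an elimination forest of $G$, the height being the largest number of vertices on a root-to-leaf path. \textbf{Theorem.} Let $d\ge 5$ be an integer and let $F$ be a graph. Then the class of $F$-subgraph-free graphs of diameter at most $d$ has bounded treedepth (that is, there is a constant $c$, depending only on $d$ and $F$, such that every $F$-subgraph-free graph of diameter at most $d$ has treedepth at most $c$) if and only if $F$ is isomorphic to a subgraph of a subdivided star. -/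

import Mathlib

namespace SimpleGraph

/-- An elimination forest of `G`: a rooted forest on the vertex set of `G`, given by its ancestor
relation (`anc u v`: the vertex `u` lies on the path from a root to `v`, ends included), such that
the ends of every edge of `G` lie on a common root-to-leaf path, that is, one of them is an
ancestor of the other. On a finite set, the ancestor relations of rooted forests are exactly the
partial orders in which the ancestors of any vertex form a chain. -/
structure EliminationForest {V : Type*} (G : SimpleGraph V) where
  /-- `anc u v` says that `u` is an ancestor of `v`, or `u = v`. -/
  anc : V → V → Prop
  refl : ∀ v, anc v v
  trans : ∀ u v w, anc u v → anc v w → anc u w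
  antisymm : ∀ u v, anc u v → anc v u → u = v
  chain : ∀ u v w, anc u w → anc v w → anc u v ∨ anc v u
  adj : ∀ u v, G.Adj u v → anc u v ∨ anc v u

/-- The height of an elimination forest: the largest number of vertices on a path from a root
to a vertex. -/
noncomputable def EliminationForest.height {V : Type*} {G : SimpleGraph V}
    (T : G.EliminationForest) : ℕ∞ :=
  ⨆ v, {u | T.anc u v}.encard

/-- The treedepth of `G`: the minimum height of an elimination forest of `G`. -/
noncomputable def treedepth {V : Type*} (G : SimpleGraph V) : ℕ∞ :=
  ⨅ T : G.EliminationForest, T.height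

/-- A subdivided star: a tree with exactly one vertex of degree at least three. -/
def IsSubdividedStar {V : Type*} (S : SimpleGraph V) : Prop :=
  S.IsTree ∧ ∃! v, 3 ≤ (S.neighborSet v).encard

end SimpleGraph

/-! For necessity, `F` must embed in every finite graph of diameter at most five and sufficiently
large treedepth. Long paths force large treedepth (`lt_two_pow_of_treedepth_le`), so it suffices to
build graphs of small diameter around long paths. A path with an apex joined to a well-chosen
dominating set avoids any one prescribed cycle length, hence `F` is acyclic. When the apex sees the
whole path, two vertices of degree at least three in a subgraph are adjacent or share a neighbour;
in a twice subdivided complete graph this never happens. Hence `F` has at most one such vertex, and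
a forest of this kind lies in a large spider.

For sufficiency, a connected graph without long paths has small treedepth by depth-first search
(`treedepth_le_of_no_path`), so large treedepth gives a long path. Bounded diameter gives a
breadth-first tree of bounded height. Since that tree contains all vertices of the path, some vertex
`w` has many children with path vertices below them (`exists_many_children`). Legs descend from `w`
through such children until they first meet the path, then run along pairwise disjoint segments of
it (`hasSpider_of_path`). The resulting spider contains the given star, and so `F`. -/

namespace SimpleGraph

/-! ### Treedepth and long paths -/

section Treedepth

variable {V : Type*} {G : SimpleGraph V}

/-- A path whose vertices have at most `c` ancestors among the vertices of the path has fewer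
than `2 ^ c` vertices. -/
lemma EliminationForest.lt_two_pow_of_path (T : G.EliminationForest) (f : ℕ → V) (c : ℕ) :
    ∀ a b : ℕ, (∀ i, a ≤ i → i + 1 < b → G.Adj (f i) (f (i + 1))) →
      Set.InjOn f (Set.Ico a b) →
      (∀ i ∈ Set.Ico a b, {j ∈ Set.Ico a b | T.anc (f j) (f i)}.ncard ≤ c) →
      b - a < 2 ^ c := by
  induction c with
  | zero =>
    intro a b _ _ hc
    by_contra! h
    have hab : a ∈ Set.Ico a b := ⟨le_rfl, by simp at h; omega⟩
    have h0 := hc a hab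
    rw [Nat.le_zero, Set.ncard_eq_zero ((Set.finite_Ico a b).subset (Set.sep_subset _ _))] at h0
    have : a ∈ ({j ∈ Set.Ico a b | T.anc (f j) (f a)} : Set ℕ) := ⟨hab, T.refl _⟩
    rw [h0] at this
    exact this
  | succ c ih =>
    intro a b hadj hinj hc
    by_cases hab : a < b
    swap
    · have : 0 < 2 ^ (c + 1) := by positivity
      omega
    -- An ancestor of `f a` with fewest ancestors on the path is minimal; as the path is connected,
    -- it lies above the whole path.
    obtain ⟨m, ⟨hm, hma⟩, hmin⟩ : ∃ m, (m ∈ Set.Ico a b ∧ T.anc (f m) (f a)) ∧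
        ∀ j ∈ Set.Ico a b, T.anc (f j) (f m) → j = m := by
      let S : Set ℕ := {j ∈ Set.Ico a b | T.anc (f j) (f a)}
      have hS : S.Finite := (Set.finite_Ico a b).subset (Set.sep_subset _ _)
      obtain ⟨m, hm, hmin⟩ := Set.exists_min_image S
        (fun i ↦ {j ∈ Set.Ico a b | T.anc (f j) (f i)}.ncard) hS ⟨a, ⟨le_rfl, hab⟩, T.refl _⟩
      refine ⟨m, hm, fun j hj hjm ↦ ?_⟩
      have hle := hmin j ⟨hj, T.trans _ _ _ hjm hm.2⟩
      by_contra hne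
      refine absurd hle (not_le.mpr (Set.ncard_lt_ncard ⟨fun i hi ↦
        ⟨hi.1, T.trans _ _ _ hi.2 hjm⟩, fun hsub ↦ ?_⟩
        ((Set.finite_Ico a b).subset (Set.sep_subset _ _))))
      have := hsub (a := m) ⟨hm.1, T.refl _⟩
      exact hne (hinj hj hm.1 (T.antisymm _ _ hjm this.2))
    have hroot : ∀ i, a ≤ i → i < b → T.anc (f m) (f i) := by
      intro i hi
      induction i, hi using Nat.le_induction with
      | base => exact fun _ ↦ hma
      | succ i hi ihi =>
        intro hib
        have hanc := ihi (by omega)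
        rcases T.adj _ _ (hadj i hi hib) with h | h
        · exact T.trans _ _ _ hanc h
        · rcases T.chain _ _ _ hanc h with h' | h'
          · exact h'
          · rw [hmin (i + 1) ⟨by omega, hib⟩ h']
            exact T.refl _
    -- Deleting `m` costs every remaining vertex one ancestor. The two pieces have fewer than `2 ^
    -- c` vertices each, and `m` adds one.
    have hcount : ∀ a' b', a ≤ a' → b' ≤ b → (m < a' ∨ b' ≤ m) → ∀ i ∈ Set.Ico a' b',
        {j ∈ Set.Ico a' b' | T.anc (f j) (f i)}.ncard ≤ c := by
      intro a' b' ha hb hmn i hi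
      have hi' : i ∈ Set.Ico a b := ⟨ha.trans hi.1, hi.2.trans_le hb⟩
      have hlt : {j ∈ Set.Ico a' b' | T.anc (f j) (f i)}.ncard <
          {j ∈ Set.Ico a b | T.anc (f j) (f i)}.ncard := by
        refine Set.ncard_lt_ncard ⟨fun j hj ↦ ⟨⟨ha.trans hj.1.1, hj.1.2.trans_le hb⟩, hj.2⟩,
          fun hsub ↦ ?_⟩ ((Set.finite_Ico a b).subset (Set.sep_subset _ _))
        have := (hsub (a := m) ⟨hm, hroot i hi'.1 hi'.2⟩).1
        simp only [Set.mem_Ico] at this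
        omega
      have := hc i hi'
      omega
    obtain ⟨hm1, hm2⟩ := hm
    have h1 := ih a m (fun i h1 h2 ↦ hadj i h1 (by omega))
      (hinj.mono (Set.Ico_subset_Ico_right hm2.le)) (hcount a m le_rfl hm2.le (.inr le_rfl))
    have h2 := ih (m + 1) b (fun i h1 h2 ↦ hadj i (by omega) (by omega))
      (hinj.mono (Set.Ico_subset_Ico_left (by omega)))
      (hcount (m + 1) b (by omega) le_rfl (.inl (by omega)))
    rw [pow_succ]
    omega

/-- A graph of treedepth at most `c` has no path on `2 ^ c` or more vertices. -/
lemma lt_two_pow_of_treedepth_le {c N : ℕ} (hG : G.treedepth ≤ c) (f : ℕ → V)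
    (hadj : ∀ i, i + 1 < N → G.Adj (f i) (f (i + 1))) (hinj : Set.InjOn f (Set.Iio N)) :
    N < 2 ^ c := by
  obtain ⟨T, hT⟩ : ∃ T : G.EliminationForest, T.height ≤ c := by
    by_contra! h
    have : ((c + 1 : ℕ) : ℕ∞) ≤ G.treedepth := le_iInf fun T ↦ by
      simpa using Order.add_one_le_of_lt (h T)
    have := this.trans hG
    norm_cast at this
    omega
  have key := T.lt_two_pow_of_path f c 0 N (fun i _ h ↦ hadj i h)
    (hinj.mono fun i hi ↦ hi.2) fun i hi ↦ ?_
  · simpa using key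
  have h1 : {u | T.anc u (f i)}.encard ≤ c := (le_iSup _ (f i)).trans hT
  have hfin : {u | T.anc u (f i)}.Finite := Set.finite_of_encard_le_coe h1
  have h2 : {u | T.anc u (f i)}.ncard ≤ c := by
    rwa [← hfin.cast_ncard_eq, Nat.cast_le] at h1
  refine le_trans ?_ h2
  exact Set.ncard_le_ncard_of_injOn f (fun j hj ↦ hj.2)
    (hinj.mono fun j hj ↦ hj.1.2) hfin

/-- `HasEliminationOn G S k` says that the subgraph of `G` induced by `S` has an elimination
forest of height at most `k`. -/
def HasEliminationOn (G : SimpleGraph V) (S : Set V) (k : ℕ) : Prop :=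
  ∃ anc : V → V → Prop, (∀ v ∈ S, anc v v) ∧
    (∀ u ∈ S, ∀ v ∈ S, ∀ w ∈ S, anc u v → anc v w → anc u w) ∧
    (∀ u ∈ S, ∀ v ∈ S, anc u v → anc v u → u = v) ∧
    (∀ u ∈ S, ∀ v ∈ S, ∀ w ∈ S, anc u w → anc v w → anc u v ∨ anc v u) ∧
    (∀ u ∈ S, ∀ v ∈ S, G.Adj u v → anc u v ∨ anc v u) ∧
    ∀ v ∈ S, {u ∈ S | anc u v}.encard ≤ k

lemma HasEliminationOn.treedepth_le {k : ℕ} (h : G.HasEliminationOn Set.univ k) :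
    G.treedepth ≤ k := by
  obtain ⟨anc, h1, h2, h3, h4, h5, h6⟩ := h
  simp only [Set.mem_univ, true_and, forall_const] at h1 h2 h3 h4 h5 h6
  exact (iInf_le _ (⟨anc, h1, h2, h3, h4, h5⟩ : G.EliminationForest)).trans (iSup_le h6)

/-- Adding a new root raises the height of an elimination forest by at most one. -/
lemma HasEliminationOn.of_diff_singleton {S : Set V} {k : ℕ} {r : V}
    (h : G.HasEliminationOn (S \ {r}) k) : G.HasEliminationOn S (k + 1) := by
  obtain ⟨anc, h1, h2, h3, h4, h5, h6⟩ := h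
  simp only [Set.mem_sdiff, Set.mem_singleton_iff] at h1 h2 h3 h4 h5 h6
  refine ⟨fun u v ↦ u = r ∨ (u ≠ r ∧ v ≠ r ∧ anc u v), ?_, ?_, ?_, ?_, ?_, ?_⟩
  · grind
  · grind
  · grind
  · grind
  · grind
  · intro v hv
    by_cases hvr : v = r
    · have : {u ∈ S | u = r ∨ (u ≠ r ∧ v ≠ r ∧ anc u v)} ⊆ {r} := by
        rintro u ⟨_, hu⟩
        simp only [hvr, ne_eq, not_true_eq_false, false_and, and_false, or_false] at hu
        exact hu
      refine (Set.encard_le_encard this).trans ?_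
      rw [Set.encard_singleton]
      exact_mod_cast Nat.le_add_left 1 k
    · have : {u ∈ S | u = r ∨ (u ≠ r ∧ v ≠ r ∧ anc u v)} ⊆
          insert r {u | (u ∈ S ∧ ¬ u = r) ∧ anc u v} := by
        rintro u ⟨hu, hu'⟩
        simp only [Set.mem_insert_iff, Set.mem_ofPred_eq]
        tauto
      refine (Set.encard_le_encard this).trans ((Set.encard_insert_le _ _).trans ?_)
      push_cast
      gcongr
      exact h6 v ⟨hv, hvr⟩

/-- Reachability inside a set of vertices. -/
def ReachIn (G : SimpleGraph V) (S : Set V) : V → V → Prop :=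
  Relation.ReflTransGen fun u v ↦ u ∈ S ∧ v ∈ S ∧ G.Adj u v

lemma ReachIn.symm {S : Set V} {u v : V} (h : G.ReachIn S u v) : G.ReachIn S v u := by
  induction h with
  | refl => exact .refl
  | tail _ h ih => exact .head ⟨h.2.1, h.1, h.2.2.symm⟩ ih

lemma ReachIn.mem {S : Set V} {u v : V} (h : G.ReachIn S u v) (hu : u ∈ S) : v ∈ S := by
  induction h with
  | refl => exact hu
  | tail _ h _ => exact h.2.1

lemma ReachIn.of_component {S : Set V} {u v : V} (h : G.ReachIn S u v) :
    G.ReachIn {w | G.ReachIn S u w} u v := by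
  induction h with
  | refl => exact .refl
  | tail h1 h2 ih => exact ih.tail ⟨h1, h1.tail h2, h2.2.2⟩

/-- Elimination forests of the components combine to an elimination forest. -/
lemma HasEliminationOn.of_components {S : Set V} {k : ℕ}
    (h : ∀ u ∈ S, G.HasEliminationOn {w | G.ReachIn S u w} k) : G.HasEliminationOn S k := by
  classical
  -- The order is chosen for the component as a set, so that all its vertices use the same one
  -- whatever representative describes it.
  have hC : ∀ C : Set V, ∃ anc : V → V → Prop,
      ∀ u ∈ S, C = {w | G.ReachIn S u w} →
      (∀ v ∈ C, anc v v) ∧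
      (∀ u ∈ C, ∀ v ∈ C, ∀ w ∈ C, anc u v → anc v w → anc u w) ∧
      (∀ u ∈ C, ∀ v ∈ C, anc u v → anc v u → u = v) ∧
      (∀ u ∈ C, ∀ v ∈ C, ∀ w ∈ C, anc u w → anc v w → anc u v ∨ anc v u) ∧
      (∀ u ∈ C, ∀ v ∈ C, G.Adj u v → anc u v ∨ anc v u) ∧
      ∀ v ∈ C, {u ∈ C | anc u v}.encard ≤ k := by
    intro C
    by_cases hex : ∃ u ∈ S, C = {w | G.ReachIn S u w}
    · obtain ⟨u, hu, rfl⟩ := hex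
      obtain ⟨anc, hanc⟩ := h u hu
      exact ⟨anc, fun _ _ _ ↦ hanc⟩
    · exact ⟨fun _ _ ↦ True, fun u hu hCu ↦ (hex ⟨u, hu, hCu⟩).elim⟩
  choose anc hanc using hC
  let C : V → Set V := fun u ↦ {w | G.ReachIn S u w}
  have hCeq : ∀ {u v}, G.ReachIn S u v → C u = C v := fun {u v} huv ↦ by
    ext w
    exact ⟨fun hw ↦ huv.symm.trans hw, fun hw ↦ huv.trans hw⟩
  have hself : ∀ u, u ∈ C u := fun u ↦ Relation.ReflTransGen.refl
  refine ⟨fun u v ↦ G.ReachIn S u v ∧ anc (C u) u v, ?_, ?_, ?_, ?_, ?_, ?_⟩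
  · exact fun v hv ↦ ⟨.refl, (hanc (C v) v hv rfl).1 v (hself v)⟩
  · rintro u hu v hv w hw ⟨huv, h1⟩ ⟨hvw, h2⟩
    rw [← hCeq huv] at h2
    exact ⟨huv.trans hvw, (hanc (C u) u hu rfl).2.1 u (hself u) v huv w (huv.trans hvw) h1 h2⟩
  · rintro u hu v hv ⟨huv, h1⟩ ⟨_, h2⟩
    rw [← hCeq huv] at h2
    exact (hanc (C u) u hu rfl).2.2.1 u (hself u) v huv h1 h2
  · rintro u hu v hv w hw ⟨huw, h1⟩ ⟨hvw, h2⟩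
    rw [hCeq huw] at h1
    rw [hCeq hvw] at h2
    beta_reduce
    rw [hCeq huw, hCeq hvw]
    exact ((hanc (C w) w hw rfl).2.2.2.1 u huw.symm v hvw.symm w (hself w) h1 h2).imp
      (⟨huw.trans hvw.symm, ·⟩) (⟨hvw.trans huw.symm, ·⟩)
  · intro u hu v hv huv
    have hr : G.ReachIn S u v := .single ⟨hu, hv, huv⟩
    beta_reduce
    rw [← hCeq hr]
    exact ((hanc (C u) u hu rfl).2.2.2.2.1 u (hself u) v hr huv).imp (⟨hr, ·⟩) (⟨hr.symm, ·⟩)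
  · intro v hv
    refine le_trans (Set.encard_le_encard ?_) ((hanc (C v) v hv rfl).2.2.2.2.2 v (hself v))
    rintro u ⟨_, huv, h1⟩
    rw [hCeq huv] at h1
    exact ⟨huv.symm, h1⟩

/-- Each component left after deleting `r` contains a neighbour of `r`, which serves as the next
root in depth-first search. -/
lemma exists_adj_reachIn_diff {S : Set V} {r w : V} (h : G.ReachIn S r w) (hw : w ≠ r) :
    ∃ x, G.Adj r x ∧ G.ReachIn (S \ {r}) w x := by
  induction h with
  | refl => exact (hw rfl).elim
  | @tail b c hb hbc ih =>
    by_cases hbr : b = r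
    · exact ⟨c, hbr ▸ hbc.2.2, .refl⟩
    · obtain ⟨x, hx, hbx⟩ := ih hbr
      exact ⟨x, hx, .head ⟨⟨hbc.2.1, hw⟩, ⟨hbc.1, hbr⟩, hbc.2.2.symm⟩ hbx⟩

/-- A connected graph in which the paths that start at some vertex `r` have at most `k` vertices
has an elimination forest of height at most `k`. -/
lemma hasEliminationOn_of_no_path (k : ℕ) : ∀ (S : Set V) (r : V), r ∈ S →
    (∀ w ∈ S, G.ReachIn S r w) →
    (∀ l : List V, (r :: l).IsChain G.Adj → (r :: l).Nodup → (∀ x ∈ l, x ∈ S) → l.length < k) →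
    G.HasEliminationOn S k := by
  induction k with
  | zero =>
    intro S r _ _ hl
    have := hl [] (by simp) (by simp) (by simp)
    omega
  | succ k ih =>
    intro S r hr hconn hl
    refine HasEliminationOn.of_diff_singleton (r := r) (.of_components fun u hu ↦ ?_)
    obtain ⟨x, hrx, hux⟩ := exists_adj_reachIn_diff (hconn u hu.1) hu.2
    -- A path from `x` inside its component extends by `r` to a path one vertex longer, so the bound
    -- drops by one.
    refine ih _ x hux (fun w hw ↦ ?_) fun l hchain hnodup hmem ↦ ?_
    · exact hux.of_component.symm.trans (ReachIn.of_component hw)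
    · have hS : ∀ y ∈ x :: l, y ∈ S \ {r} := by
        intro y hy
        rcases List.mem_cons.mp hy with rfl | hy
        · exact hux.mem hu
        · exact ReachIn.mem (hmem y hy) hu
      have := hl (x :: l) (List.isChain_cons_cons.mpr ⟨hrx, hchain⟩)
        (List.nodup_cons.mpr ⟨fun h ↦ (hS r h).2 rfl, hnodup⟩) (fun y hy ↦ (hS y hy).1)
      simp only [List.length_cons] at this
      omega

/-- A connected graph without a path on `N + 1` vertices has treedepth at most `N`. -/
lemma treedepth_le_of_no_path (hG : G.Preconnected) {N : ℕ}
    (h : ∀ l : List V, l.IsChain G.Adj → l.Nodup → l.length ≤ N) : G.treedepth ≤ N := by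
  refine HasEliminationOn.treedepth_le ?_
  rcases isEmpty_or_nonempty V with hV | ⟨⟨r⟩⟩
  · exact ⟨fun _ _ ↦ True, by simp⟩
  · refine hasEliminationOn_of_no_path N _ r trivial (fun w _ ↦ ?_) fun l h1 h2 _ ↦ h _ h1 h2
    obtain ⟨p⟩ := hG r w
    induction p with
    | nil => exact .refl
    | cons hadj _ ih => exact .head ⟨trivial, trivial, hadj⟩ (ih trivial)

end Treedepth

/-! ### Forests with one branching vertex embed in spiders -/

section Spider

variable {V U : Type*} {G : SimpleGraph V} {H : SimpleGraph U}

/-- `G.HasSpider k l` says that `G` contains a vertex `c` together with `k` paths on `l` further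
vertices that start at neighbours of `c` and are pairwise disjoint. -/
def HasSpider (G : SimpleGraph V) (k l : ℕ) : Prop :=
  ∃ (c : V) (leg : Fin k → ℕ → V),
    (∀ i, 0 < l → G.Adj c (leg i 0)) ∧
    (∀ i t, t + 1 < l → G.Adj (leg i t) (leg i (t + 1))) ∧
    (∀ i t, t < l → leg i t ≠ c) ∧
    ∀ i t j s, t < l → s < l → leg i t = leg j s → i = j ∧ t = s

/-- A vertex of degree less than three has no three different neighbours. -/
lemma eq_or_eq_or_eq_of_adj {u a b c : U} (hu : ¬ 3 ≤ (H.neighborSet u).encard)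
    (ha : H.Adj u a) (hb : H.Adj u b) (hc : H.Adj u c) : a = b ∨ a = c ∨ b = c := by
  by_contra! h
  refine hu ?_
  have : ({a, b, c} : Set U).encard = 3 := Set.encard_eq_three.mpr ⟨a, b, c, h.1, h.2.1, h.2.2, rfl⟩
  rw [← this]
  refine Set.encard_le_encard ?_
  rintro x (rfl | rfl | rfl) <;> assumption

/-- Either neighbour is the penultimate vertex of a shortest path from `r` to `u`, and paths in a
forest are unique. Thus parents are well defined. -/
lemma IsAcyclic.eq_of_adj_of_dist (hH : H.IsAcyclic) {r u a b : U} (hr : H.Reachable r u)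
    (ha : H.Adj u a) (hb : H.Adj u b) (hda : H.dist r u = H.dist r a + 1)
    (hdb : H.dist r u = H.dist r b + 1) : a = b := by
  have key : ∀ x, H.Adj u x → H.dist r u = H.dist r x + 1 →
      ∃ p : H.Walk r u, p.IsPath ∧ x = p.penultimate := by
    intro x hx hd
    obtain ⟨q, hq⟩ := (hr.trans hx.reachable).exists_walk_length_eq_dist
    refine ⟨q.concat hx.symm, Walk.isPath_of_length_eq_dist _ ?_, by simp⟩
    rw [Walk.length_concat, hq, hd]
  obtain ⟨p, hp, rfl⟩ := key a ha hda
  obtain ⟨q, hq, rfl⟩ := key b hb hdb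
  rw [Subtype.mk.inj ((hH.subsingleton_path r u).elim ⟨p, hp⟩ ⟨q, hq⟩)]

/-- Every component of a finite acyclic graph has a vertex with at most one neighbour. -/
lemma IsAcyclic.exists_reachable_leaf [Finite U] (hH : H.IsAcyclic) (u : U) :
    ∃ r, H.Reachable u r ∧ ∀ a b, H.Adj r a → H.Adj r b → a = b := by
  obtain ⟨r, hr, hmax⟩ := Set.exists_max_image {r | H.Reachable u r} (H.dist u)
    (Set.toFinite _) ⟨u, Reachable.refl _⟩
  have hd : ∀ a, H.Adj r a → H.dist u r = H.dist u a + 1 := by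
    intro a ha
    have h1 := hmax a (Reachable.trans hr ha.reachable)
    have h2 := hH.dist_eq_dist_add_one_of_adj_of_reachable u ha hr
    omega
  exact ⟨r, hr, fun a b ha hb ↦ hH.eq_of_adj_of_dist hr ha hb (hd a ha) (hd b hb)⟩

/-- A finite acyclic graph in which all vertices but `v` have degree at most two is a subgraph of
a tree with root `v` in which only `v` may have more than one child. The tree is given by its
parent function and its level function. -/
lemma IsAcyclic.exists_parent [Finite U] (hH : H.IsAcyclic) (v : U)
    (hv : ∀ u, u ≠ v → ¬ 3 ≤ (H.neighborSet u).encard) :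
    ∃ (f : U → U) (L : U → ℕ), L v = 0 ∧ (∀ u, u ≠ v → L u = L (f u) + 1) ∧
      (∀ u w, f u = f w → f u ≠ v → u = w) ∧
      ∀ u w, H.Adj u w → (u ≠ v ∧ f u = w) ∨ (w ≠ v ∧ f w = u) := by
  classical
  -- Components without `v` are rooted at a leaf: then the root has at most one child, as does every
  -- other vertex there, having degree at most two.
  have hroot : ∀ C : H.ConnectedComponent, ∃ r, H.connectedComponentMk r = C ∧
      (C = H.connectedComponentMk v → r = v) ∧
      (C ≠ H.connectedComponentMk v → ∀ a b, H.Adj r a → H.Adj r b → a = b) := by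
    intro C
    by_cases hC : C = H.connectedComponentMk v
    · exact ⟨v, hC.symm, fun _ ↦ rfl, fun h ↦ (h hC).elim⟩
    · obtain ⟨u, rfl⟩ := C.exists_rep
      obtain ⟨r, hr, hleaf⟩ := hH.exists_reachable_leaf u
      exact ⟨r, (ConnectedComponent.sound hr).symm, fun h ↦ (hC h).elim, fun _ ↦ hleaf⟩
  choose root hroot_mk hroot_v hroot_leaf using hroot
  let ρ : U → U := fun u ↦ root (H.connectedComponentMk u)
  have hρ : ∀ u, H.Reachable (ρ u) u := fun u ↦ ConnectedComponent.exact (hroot_mk _)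
  have hρ_adj : ∀ {u w}, H.Adj u w → ρ u = ρ w := fun {u w} h ↦ by
    simp only [ρ, ConnectedComponent.sound h.reachable]
  have hρv : ρ v = v := hroot_v _ rfl
  have hleaf : ∀ u, ρ u ≠ v → ∀ a b, H.Adj (ρ u) a → H.Adj (ρ u) b → a = b := fun u hu ↦
    hroot_leaf _ fun h ↦ hu (hroot_v _ h)
  let D : U → ℕ := fun u ↦ H.dist (ρ u) u
  have hD0 : ∀ u, D u = 0 ↔ u = ρ u := fun u ↦ by
    rw [(hρ u).dist_eq_zero_iff]; exact eq_comm
  have hpar : ∀ u, u ≠ ρ u → ∃ w, H.Adj u w ∧ D u = D w + 1 := by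
    intro u hu
    obtain ⟨q, hq⟩ := (hρ u).exists_walk_length_eq_dist
    have hnil : ¬ q.Nil := fun h ↦ hu h.eq.symm
    refine ⟨q.penultimate, (q.adj_penultimate hnil).symm, ?_⟩
    have h1 : H.dist (ρ u) q.penultimate ≤ q.dropLast.length := dist_le _
    have h2 := hH.dist_eq_dist_add_one_of_adj_of_reachable (ρ u) (q.adj_penultimate hnil).symm (hρ u)
    have h3 : 0 < q.length := Walk.not_nil_iff_lt_length.mp hnil
    have h4 := q.length_dropLast_add_one hnil
    simp only [D]
    rw [← hρ_adj (q.adj_penultimate hnil).symm]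
    omega
  choose! g hg_adj hg_D using hpar
  have hg_eq : ∀ u w, H.Adj u w → D u = D w + 1 → g u = w := by
    intro u w huw hd
    have hu : u ≠ ρ u := fun h ↦ by
      have := (hD0 u).mpr h
      omega
    refine hH.eq_of_adj_of_dist (hρ u) (hg_adj u hu) huw ?_ ?_
    · have := hg_D u hu
      simp only [D] at this
      rwa [← hρ_adj (hg_adj u hu)] at this
    · simp only [D] at hd
      rwa [← hρ_adj huw] at hd
  have hadj : ∀ u w, H.Adj u w → (u ≠ ρ u ∧ g u = w) ∨ (w ≠ ρ w ∧ g w = u) := by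
    intro u w huw
    rcases hH.dist_eq_dist_add_one_of_adj_of_reachable (ρ u) huw (hρ u) with h | h
    · have hd : D u = D w + 1 := by
        simp only [D]
        rwa [← hρ_adj huw]
      refine .inl ⟨fun h' ↦ ?_, hg_eq u w huw hd⟩
      have := (hD0 u).mpr h'
      omega
    · have hd : D w = D u + 1 := by
        simp only [D]
        rwa [← hρ_adj huw]
      refine .inr ⟨fun h' ↦ ?_, hg_eq w u huw.symm hd⟩
      have := (hD0 w).mpr h'
      omega
  have hv_ne : ∀ u, u ≠ ρ u → u ≠ v := fun u hu h ↦ hu (by rw [h, hρv])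
  -- The other roots are hung below `v`, which pushes their components down one level.
  refine ⟨fun u ↦ if u = ρ u then v else g u, fun u ↦ D u + if ρ u = v then 0 else 1,
    ?_, ?_, ?_, ?_⟩
  · simp [hρv, (hD0 v).mpr hρv.symm]
  · intro u hu
    by_cases h : u = ρ u
    · have : ρ u ≠ v := h ▸ hu
      simp only [if_pos h, if_neg this, (hD0 u).mpr h, (hD0 v).mpr hρv.symm, hρv, if_true]
    · simp only [if_neg h]
      rw [hg_D u h, hρ_adj (hg_adj u h)]
      omega
  · intro u w huw hne
    have hu : u ≠ ρ u := fun h ↦ hne (if_pos h)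
    have hw : w ≠ ρ w := fun h ↦ hne (huw.trans (if_pos h))
    simp only [if_neg hu, if_neg hw] at huw hne
    -- A root other than `v` is a leaf. A non-root parent has its own parent as a further neighbour,
    -- so two distinct children would give it degree three.
    by_cases hx : g u = ρ (g u)
    · have hu' := (hg_adj u hu).symm
      have hw' := (hg_adj w hw).symm
      rw [← huw, hx] at hw'
      rw [hx] at hu'
      exact hleaf (g u) (hx ▸ hne) u w hu' hw'
    · rcases eq_or_eq_or_eq_of_adj (hv _ hne) (hg_adj u hu).symm (huw ▸ (hg_adj w hw).symm)
        (hg_adj _ hx) with h | h | h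
      · exact h
      · have h1 := hg_D u hu
        have h2 := hg_D _ hx
        rw [← h] at h2
        omega
      · have h1 := hg_D w hw
        have h2 := hg_D _ hx
        rw [← h, huw] at h2
        omega
  · intro u w huw
    refine (hadj u w huw).imp (fun h ↦ ⟨hv_ne u h.1, ?_⟩) (fun h ↦ ⟨hv_ne w h.1, ?_⟩)
    · beta_reduce
      rw [if_neg h.1, h.2]
    · beta_reduce
      rw [if_neg h.1, h.2]

/-- A finite acyclic graph with at most one vertex of degree at least three is contained in every
sufficiently large spider. -/
lemma IsAcyclic.isContained_of_hasSpider [Finite U] (hH : H.IsAcyclic) (v : U)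
    (hv : ∀ u, u ≠ v → ¬ 3 ≤ (H.neighborSet u).encard) {k l : ℕ} (hk : Nat.card U ≤ k)
    (hl : Nat.card U ≤ l) (hG : G.HasSpider k l) : H ⊑ G := by
  classical
  obtain ⟨f, L, hLv, hLf, hinj, hadj⟩ := hH.exists_parent v hv
  obtain ⟨c, leg, hc0, hstep, hlegc, hleginj⟩ := hG
  let e : U → Fin k := fun u ↦ Fin.castLE hk (Finite.equivFin U u)
  have he : Function.Injective e := (Fin.castLE_injective hk).comp (Equiv.injective _)
  have hpos : ∀ u, u ≠ v → 0 < L u := fun u hu ↦ by rw [hLf u hu]; omega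
  have hne : ∀ u, 0 < L u → u ≠ v := fun u hu h ↦ by rw [h, hLv] at hu; omega
  have hiter : ∀ i u, i ≤ L u → L (f^[i] u) = L u - i := by
    intro i
    induction i with
    | zero => simp
    | succ i ih =>
      intro u hu
      have h1 := ih u (by omega)
      have h2 := hLf (f^[i] u) (hne _ (by omega))
      rw [Function.iterate_succ_apply']
      omega
  have hLlt : ∀ u, L u < Nat.card U := by
    intro u
    have : Set.InjOn (fun i ↦ f^[i] u) (Finset.range (L u + 1) : Set ℕ) := by
      intro i hi j hj hij
      simp only [Finset.coe_range, Set.mem_Iio] at hi hj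
      have h1 := hiter i u (by omega)
      have h2 := hiter j u (by omega)
      simp only at hij
      rw [hij] at h1
      omega
    have := Finset.card_image_of_injOn this
    rw [Finset.card_range] at this
    have hle : (Finset.image (fun i ↦ f^[i] u) (Finset.range (L u + 1))).card ≤ Nat.card U := by
      have := Fintype.ofFinite U
      rw [Nat.card_eq_fintype_card]
      exact Finset.card_le_univ _
    omega
  have hcancel : ∀ i u w, L u = L w → i < L u → f^[i] u = f^[i] w → u = w := by
    intro i
    induction i with
    | zero => exact fun _ _ _ _ h ↦ h
    | succ i ih =>
      intro u w hL hi h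
      rw [Function.iterate_succ_apply', Function.iterate_succ_apply'] at h
      refine ih u w hL (by omega) (hinj _ _ h (hne _ ?_))
      rw [← Function.iterate_succ_apply' f, hiter _ _ hi.le]
      omega
  -- The ancestor of `u` at level one selects the leg, and the level of `u` the position on it.
  let φ : U → V := fun u ↦ if u = v then c else leg (e (f^[L u - 1] u)) (L u - 1)
  have hφ : ∀ u w, u ≠ v → f u = w → G.Adj (φ u) (φ w) := by
    rintro u _ hu rfl
    have hLu := hLf u hu
    have hlt := hLlt u
    by_cases hw : f u = v
    · have : L u = 1 := by rw [hLu, hw, hLv]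
      simp only [φ, if_neg hu, if_pos hw, this]
      exact (hc0 _ (by omega)).symm
    · have h1 : L u - 1 = (L (f u) - 1) + 1 := by
        have := hpos _ hw
        omega
      simp only [φ, if_neg hu, if_neg hw]
      rw [h1, Function.iterate_succ_apply]
      exact (hstep _ _ (by omega)).symm
  refine ⟨⟨⟨φ, fun {u w} huw ↦ ?_⟩, fun u w huw ↦ ?_⟩⟩
  · rcases hadj u w huw with h | h
    · exact hφ u w h.1 h.2
    · exact (hφ w u h.1 h.2).symm
  · change φ u = φ w at huw
    by_cases hu : u = v <;> by_cases hw : w = v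
    · rw [hu, hw]
    · simp only [φ, if_pos hu, if_neg hw] at huw
      have := hLlt w
      exact (hlegc _ _ (by omega) huw.symm).elim
    · simp only [φ, if_pos hw, if_neg hu] at huw
      have := hLlt u
      exact (hlegc _ _ (by omega) huw).elim
    · simp only [φ, if_neg hu, if_neg hw] at huw
      have h1 := hLlt u
      have h2 := hLlt w
      have h3 := hpos u hu
      have h4 := hpos w hw
      obtain ⟨h5, h6⟩ := hleginj _ _ _ _ (by omega) (by omega) huw
      have h7 : L u = L w := by omega
      rw [← h7] at h5
      exact hcancel _ _ _ h7 (by omega) (he h5)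

end Spider

/-! ### A long path in bounded radius yields a spider -/

section LongPath

variable {V : Type*}

/-- The number of vertices of a rooted forest of height at most `e + 1` that force a vertex with
at least `K` children. -/
def branchBound (K : ℕ) : ℕ → ℕ
  | 0 => 1
  | e + 1 => K * branchBound K e + 1

lemma level_iterate {f : V → V} {D : V → ℕ} (hD : ∀ u, D u ≠ 0 → D u = D (f u) + 1)
    (i : ℕ) (u : V) (hi : i ≤ D u) : D (f^[i] u) = D u - i := by
  induction i with
  | zero => simp
  | succ i ih =>
    have h1 := ih (by omega)
    have h2 := hD (f^[i] u) (by omega)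
    rw [Function.iterate_succ_apply']
    omega

/-- Among many vertices of small level in a rooted forest, given by its parent function `f` and
its level function `D`, some vertex has `K` children with descendants in the given set. -/
lemma exists_many_children {f : V → V} {D : V → ℕ} (hD : ∀ u, D u ≠ 0 → D u = D (f u) + 1)
    (K e : ℕ) : ∀ (v : V) (Y : Finset V),
      (∀ y ∈ Y, ∃ j ≤ e, f^[j] y = v ∧ D y = D v + j) → branchBound K e < Y.card →
      ∃ (w : V) (C : Finset V), C.card = K ∧ ∀ c ∈ C, f c = w ∧ D c = D w + 1 ∧
        ∃ j, ∃ y ∈ Y, f^[j] y = c ∧ D y = D c + j := by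
  classical
  induction e with
  | zero =>
    intro v Y hY hcard
    have : Y ⊆ {v} := fun y hy ↦ by
      obtain ⟨j, hj, h, _⟩ := hY y hy
      obtain rfl : j = 0 := by omega
      simpa using h
    have := Finset.card_le_card this
    simp only [branchBound, Finset.card_singleton] at hcard this
    omega
  | succ e ih =>
    intro v Y hY hcard
    -- The ancestor of `y` just below `v`. Either there are `K` of these, or by pigeonhole one of
    -- them has many members of `Y` below it.
    let child : V → V := fun y ↦ f^[D y - D v - 1] y
    have hchild : ∀ y ∈ Y.erase v, f (child y) = v ∧ D (child y) = D v + 1 ∧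
        D y - D v - 1 ≤ e ∧ D y = D (child y) + (D y - D v - 1) := by
      intro y hy
      obtain ⟨hyv, hyY⟩ := Finset.mem_erase.mp hy
      obtain ⟨j, hj, h, hDy⟩ := hY y hyY
      have hj0 : j ≠ 0 := by
        rintro rfl
        exact hyv h
      have h1 := level_iterate hD (D y - D v - 1) y (by omega)
      refine ⟨?_, ?_, by omega, ?_⟩
      · simp only [child]
        rw [← Function.iterate_succ_apply' f]
        have hj' : (D y - D v - 1).succ = j := by omega
        rw [hj', h]
      · simp only [child]
        omega
      · simp only [child]
        omega
    by_cases hK : K ≤ ((Y.erase v).image child).card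
    · obtain ⟨C, hC, hCK⟩ := Finset.exists_subset_card_eq hK
      refine ⟨v, C, hCK, fun c hc ↦ ?_⟩
      obtain ⟨y, hy, rfl⟩ := Finset.mem_image.mp (hC hc)
      obtain ⟨h1, h2, _, h4⟩ := hchild y hy
      exact ⟨h1, h2, _, y, Finset.mem_of_mem_erase hy, rfl, h4⟩
    · have hlt : ((Y.erase v).image child).card * branchBound K e < (Y.erase v).card := by
        have h1 : Y.card - 1 ≤ (Y.erase v).card := Finset.pred_card_le_card_erase
        have h2 : ((Y.erase v).image child).card * branchBound K e ≤ K * branchBound K e :=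
          Nat.mul_le_mul_right _ (by omega)
        simp only [branchBound] at hcard
        omega
      obtain ⟨c, _, hc⟩ := Finset.exists_lt_card_fiber_of_mul_lt_card_of_maps_to
        (fun y hy ↦ Finset.mem_image_of_mem child hy) hlt
      obtain ⟨w, C, hCK, hC⟩ := ih c _ (fun y hy ↦ by
        obtain ⟨hy', rfl⟩ := Finset.mem_filter.mp hy
        exact ⟨_, (hchild y hy').2.2.1, rfl, (hchild y hy').2.2.2⟩) hc
      refine ⟨w, C, hCK, fun c hc ↦ ?_⟩
      obtain ⟨h1, h2, j, y, hy, h3⟩ := hC c hc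
      exact ⟨h1, h2, j, y, Finset.mem_of_mem_erase (Finset.mem_filter.mp hy).1, h3⟩

/-- A connected graph of bounded radius with a long path contains a large spider. -/
lemma hasSpider_of_path {G : SimpleGraph V} (hG : G.Connected) {d : ℕ} (r : V)
    (hd : ∀ u, G.dist r u ≤ d) (k l : ℕ) (hl : 0 < l) (p : ℕ → V)
    (hadj : ∀ i, i + 1 < 2 * l * (branchBound (2 * l * (k + 1)) d + 1) → G.Adj (p i) (p (i + 1)))
    (hinj : Set.InjOn p (Set.Iio (2 * l * (branchBound (2 * l * (k + 1)) d + 1)))) :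
    G.HasSpider k l := by
  classical
  -- The path is cut into `M` segments of `m = 2 * l` vertices. With `m * (k + 1)` children, at
  -- least `k + 1` segments are hit, and one can be sacrificed.
  set M := branchBound (2 * l * (k + 1)) d + 1 with hM
  set m := 2 * l with hm
  have hm0 : 0 < m := by omega
  have hpar : ∀ u, G.dist r u ≠ 0 → ∃ w, G.Adj u w ∧ G.dist r u = G.dist r w + 1 := by
    intro u hu
    obtain ⟨q, hq⟩ := hG.exists_walk_length_eq_dist r u
    have hnil : ¬ q.Nil := fun h ↦ hu (by rw [← hq]; exact Walk.length_eq_zero_iff.mpr h)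
    refine ⟨q.penultimate, (q.adj_penultimate hnil).symm, ?_⟩
    have h1 : G.dist r q.penultimate ≤ q.dropLast.length := dist_le _
    have h2 := (q.adj_penultimate hnil).diff_dist_adj (u := r)
    have h3 := q.length_dropLast_add_one hnil
    omega
  choose! f hf_adj hf_D using hpar
  let D : V → ℕ := G.dist r
  have hD0 : ∀ u, D u = 0 ↔ r = u := fun u ↦ hG.dist_eq_zero_iff
  have hX : ∀ y ∈ (Finset.range (m * M)).image p, ∃ j ≤ d, f^[j] y = r ∧ D y = D r + j := by
    intro y _
    refine ⟨D y, hd y, ?_, ?_⟩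
    · have := level_iterate (D := D) hf_D (D y) y le_rfl
      rw [Nat.sub_self, hD0] at this
      exact this.symm
    · rw [(hD0 r).mpr rfl, zero_add]
  have hXcard : branchBound (m * (k + 1)) d < ((Finset.range (m * M)).image p).card := by
    rw [Finset.card_image_of_injOn (by simpa using hinj), Finset.card_range]
    calc _ < M := by omega
      _ = 1 * M := (one_mul M).symm
      _ ≤ m * M := Nat.mul_le_mul_right _ hm0
  obtain ⟨w, C, hCK, hC⟩ := exists_many_children (D := D) hf_D _ d r _ hX hXcard
  -- A path vertex nearest below `c` is chosen, so that the tree route from `c` to it meets the path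
  -- only at its end.
  have hnear : ∀ c ∈ C, ∃ j, ∃ i < m * M, f^[j] (p i) = c ∧ D (p i) = D c + j ∧
      ∀ j' < j, ∀ i' < m * M, f^[j'] (p i') = c → D (p i') ≠ D c + j' := by
    intro c hc
    have hex : ∃ j, ∃ i < m * M, f^[j] (p i) = c ∧ D (p i) = D c + j := by
      obtain ⟨_, _, j, y, hy, h⟩ := hC c hc
      obtain ⟨i, hi, rfl⟩ := Finset.mem_image.mp hy
      exact ⟨j, i, Finset.mem_range.mp hi, h⟩
    obtain ⟨i, hi, h1, h2⟩ := Nat.find_spec hex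
    exact ⟨_, i, hi, h1, h2, fun j' hj' i' hi' h1' h2' ↦
      Nat.find_min hex hj' ⟨i', hi', h1', h2'⟩⟩
  choose! J I hI hIc hID hmin using hnear
  have hIinj : Set.InjOn I C := by
    intro c hc c' hc' h
    have h1 := hIc c hc
    have h2 := hID c hc
    rw [h] at h1 h2
    have h3 := hID c' hc'
    rw [(hC c hc).2.1] at h2
    rw [(hC c' hc').2.1] at h3
    have hJ : J c = J c' := by omega
    have h4 := hIc c' hc'
    rw [← hJ] at h4
    exact h1.symm.trans h4
  have hdiv : ∀ q t : ℕ, t < m → (m * q + t) / m = q := fun q t ht ↦ by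
    rw [Nat.mul_add_div hm0, Nat.div_eq_of_lt ht, add_zero]
  have hseg : k + 1 ≤ (C.image fun c ↦ I c / m).card := by
    have h1 : C.card ≤ m * (C.image fun c ↦ I c / m).card := by
      refine Finset.card_le_mul_card_image C m fun q _ ↦ ?_
      rw [← Finset.card_image_of_injOn (f := I)
        (hIinj.mono fun c hc ↦ (Finset.mem_filter.mp hc).1)]
      refine le_of_le_of_eq (Finset.card_le_card_of_injOn (t := Finset.range m)
        (fun i ↦ i % m) (fun i _ ↦ ?_) ?_) (Finset.card_range m)
      · simp [Nat.mod_lt _ hm0]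
      · intro i hi i' hi' h
        simp only [Finset.coe_image, Set.mem_image, Finset.mem_coe, Finset.mem_filter] at hi hi'
        obtain ⟨c, ⟨_, hc⟩, rfl⟩ := hi
        obtain ⟨c', ⟨_, hc'⟩, rfl⟩ := hi'
        have h3 := Nat.div_add_mod (I c) m
        have h4 := Nat.div_add_mod (I c') m
        simp only at h
        rw [← h3, ← h4, h, hc, hc']
    rw [hCK] at h1
    exact Nat.le_of_mul_le_mul_left h1 hm0
  -- The segment that may contain the centre `w` is discarded.
  obtain ⟨q₀, hq₀⟩ : ∃ q₀, ∀ i < m * M, p i = w → i / m = q₀ := by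
    by_cases h : ∃ i < m * M, p i = w
    · obtain ⟨i, hi, hiw⟩ := h
      exact ⟨i / m, fun i' hi' h ↦ by rw [hinj hi' hi (h.trans hiw.symm)]⟩
    · exact ⟨0, fun i hi hiw ↦ (h ⟨i, hi, hiw⟩).elim⟩
  obtain ⟨Q, hQ, hQk⟩ : ∃ Q ⊆ (C.image fun c ↦ I c / m).erase q₀, Q.card = k := by
    refine Finset.exists_subset_card_eq ?_
    have := Finset.pred_card_le_card_erase (s := C.image fun c ↦ I c / m) (a := q₀)
    omega
  let seg : Fin k ≃ Q := (Q.equivFinOfCardEq hQk).symm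
  have hrep : ∀ a : Fin k, ∃ c ∈ C, I c / m = seg a := fun a ↦ by
    simpa using Finset.mem_of_mem_erase (hQ (seg a).2)
  have hseg_ne : ∀ a : Fin k, (seg a : ℕ) ≠ q₀ := fun a ↦ Finset.ne_of_mem_erase (hQ (seg a).2)
  choose c hcC hcseg using hrep
  have hc_inj : ∀ a b, (seg a : ℕ) = seg b → a = b := fun a b h ↦
    seg.injective (Subtype.ext h)
  -- From its meeting point the leg turns towards the farther end of the segment, so `l` vertices
  -- fit. Truncated subtraction keeps the index fixed for the `J (c a)` steps down the tree.
  let idx : Fin k → ℕ → ℕ := fun a t ↦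
    if I (c a) % m < l then I (c a) + (t - J (c a)) else I (c a) - (t - J (c a))
  have hidx_seg : ∀ a t, t < l → idx a t / m = seg a := by
    intro a t ht
    have h1 := Nat.div_add_mod (I (c a)) m
    have h2 := Nat.mod_lt (I (c a)) hm0
    rw [← hcseg a]
    simp only [idx]
    split_ifs with h
    · rw [← hdiv (I (c a) / m) (I (c a) % m + (t - J (c a))) (by omega)]
      congr 1
      omega
    · rw [← hdiv (I (c a) / m) (I (c a) % m - (t - J (c a))) (by omega)]
      congr 1
      omega
  have hidx_lt : ∀ a t, t < l → idx a t < m * M := by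
    intro a t ht
    have h1 := hidx_seg a t ht
    rw [← hcseg a] at h1
    have h2 : I (c a) / m < M := Nat.div_lt_of_lt_mul (hI _ (hcC a))
    rw [← h1] at h2
    rw [mul_comm]
    exact (Nat.div_lt_iff_lt_mul hm0).mp h2
  have hidx_le : ∀ a t, t ≤ J (c a) → idx a t = I (c a) := by
    intro a t ht
    simp [idx, Nat.sub_eq_zero_of_le ht]
  let leg : Fin k → ℕ → V := fun a t ↦ f^[J (c a) - t] (p (idx a t))
  have hleg_ge : ∀ a t, J (c a) ≤ t → leg a t = p (idx a t) := by
    intro a t ht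
    simp [leg, Nat.sub_eq_zero_of_le ht]
  have hleg_top : ∀ a t, t ≤ J (c a) → f^[t] (leg a t) = c a := by
    intro a t ht
    simp only [leg]
    rw [hidx_le a t ht, ← Function.iterate_add_apply, Nat.add_sub_cancel' ht, hIc _ (hcC a)]
  have hleg_D : ∀ a t, t ≤ J (c a) → D (leg a t) = D w + 1 + t := by
    intro a t ht
    have h1 := hID _ (hcC a)
    have h2 := (hC _ (hcC a)).2.1
    have h3 := level_iterate (D := D) hf_D (J (c a) - t) (p (idx a t))
      (by rw [hidx_le a t ht]; omega)
    rw [hidx_le a t ht] at h3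
    simp only [leg]
    rw [hidx_le a t ht]
    omega
  have hleg_notMem : ∀ a t i, t < J (c a) → i < m * M → leg a t ≠ p i := by
    intro a t i ht hi h
    refine hmin _ (hcC a) t ht i hi (h ▸ hleg_top a t ht.le) ?_
    rw [← h, hleg_D a t ht.le, (hC _ (hcC a)).2.1]
  refine ⟨w, leg, fun a _ ↦ ?_, fun a t ht ↦ ?_, fun a t ht h ↦ ?_, fun a t b s ht hs h ↦ ?_⟩
  · have h1 := hleg_top a 0 (Nat.zero_le _)
    obtain ⟨h2, h3, _⟩ := hC _ (hcC a)
    rw [Function.iterate_zero_apply] at h1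
    rw [h1, ← h2]
    refine (hf_adj _ ?_).symm
    change D (c a) ≠ 0
    omega
  · by_cases hJ : t < J (c a)
    · have h1 : leg a t = f (leg a (t + 1)) := by
        simp only [leg]
        rw [hidx_le a t hJ.le, hidx_le a (t + 1) hJ, ← Function.iterate_succ_apply' f]
        congr 2
        omega
      rw [h1]
      refine (hf_adj _ ?_).symm
      have := hleg_D a (t + 1) hJ
      change D _ ≠ 0
      omega
    · rw [hleg_ge a t (by omega), hleg_ge a (t + 1) (by omega)]
      have h1 := hidx_lt a t (by omega)
      have h2 := hidx_lt a (t + 1) ht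
      have h3 := Nat.mod_le (I (c a)) m
      by_cases h : I (c a) % m < l
      · simp only [idx, if_pos h] at h1 h2 ⊢
        have h4 : I (c a) + (t + 1 - J (c a)) = I (c a) + (t - J (c a)) + 1 := by omega
        rw [h4] at h2 ⊢
        exact hadj _ h2
      · simp only [idx, if_neg h] at h1 h2 ⊢
        have h4 : I (c a) - (t - J (c a)) = I (c a) - (t + 1 - J (c a)) + 1 := by omega
        rw [h4] at h1 ⊢
        exact (hadj _ h1).symm
  · by_cases hJ : t ≤ J (c a)
    · have := hleg_D a t hJ
      rw [h] at this
      omega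
    · rw [hleg_ge a t (by omega)] at h
      exact hseg_ne a ((hidx_seg a t ht).symm.trans (hq₀ _ (hidx_lt a t ht) h))
  -- Tree parts are separated by level and by the child above them, path parts by segment; a tree
  -- part before its end never meets the path.
  · by_cases h1 : t < J (c a) <;> by_cases h2 : s < J (c b)
    · have h3 := hleg_D a t h1.le
      have h4 := hleg_D b s h2.le
      rw [h] at h3
      obtain rfl : t = s := by omega
      have h5 := hleg_top a t h1.le
      rw [h, hleg_top b t h2.le] at h5
      refine ⟨hc_inj _ _ ?_, rfl⟩
      rw [← hcseg a, ← hcseg b, h5]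
    · rw [hleg_ge b s (by omega)] at h
      exact (hleg_notMem a t _ h1 (hidx_lt b s hs) h).elim
    · rw [hleg_ge a t (by omega)] at h
      exact (hleg_notMem b s _ h2 (hidx_lt a t ht) h.symm).elim
    · rw [hleg_ge a t (by omega), hleg_ge b s (by omega)] at h
      have h3 := hinj (hidx_lt a t ht) (hidx_lt b s hs) h
      obtain rfl : a = b := hc_inj _ _ (by rw [← hidx_seg a t ht, ← hidx_seg b s hs, h3])
      refine ⟨rfl, ?_⟩
      have h4 := Nat.mod_lt (I (c a)) hm0
      have h5 := Nat.mod_le (I (c a)) m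
      simp only [idx] at h3
      split_ifs at h3 <;> omega

end LongPath

/-! ### Graphs of small diameter and large treedepth; spiders -/

section Constructions

lemma exists_three_of_encard {V : Type*} {S : Set V} (h : 3 ≤ S.encard) :
    ∃ a ∈ S, ∃ b ∈ S, ∃ c ∈ S, a ≠ b ∧ a ≠ c ∧ b ≠ c := by
  obtain ⟨T, hTS, hT⟩ := Set.exists_subset_encard_eq h
  obtain ⟨a, b, c, hab, hac, hbc, rfl⟩ := Set.encard_eq_three.mp hT
  exact ⟨a, hTS (by simp), b, hTS (by simp), c, hTS (by simp), hab, hac, hbc⟩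

/-- The path on `N` vertices together with an apex `none` that is adjacent to the vertices of the
path whose position satisfies `A`. -/
def fan (A : ℕ → Prop) (N : ℕ) : SimpleGraph (Option (Fin N)) where
  Adj
    | none, none => False
    | none, some i => A i
    | some i, none => A i
    | some i, some j => i.1 + 1 = j ∨ j.1 + 1 = i
  symm := ⟨by
    rintro (_ | i) (_ | j) h
    · exact h
    · exact h
    · exact h
    · exact h.symm⟩
  loopless := ⟨by
    rintro (_ | i) h
    · exact h
    · rcases h with h | h <;> omega⟩

section Fan

variable {A : ℕ → Prop} {N : ℕ}

lemma fan_ediam_le (hA : ∀ i < N, ∃ j < N, A j ∧ (i = j ∨ i + 1 = j ∨ j + 1 = i)) :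
    (fan A N).ediam ≤ 4 := by
  have key : ∀ u, (fan A N).edist none u ≤ 2 := by
    rintro (_ | i)
    · simp
    · obtain ⟨j, hj, hAj, h⟩ := hA i i.2
      have h1 : (fan A N).Adj none (some ⟨j, hj⟩) := hAj
      rcases eq_or_ne i.1 j with hij | hij
      · obtain rfl : i = ⟨j, hj⟩ := Fin.ext hij
        rw [edist_eq_one_iff_adj.mpr h1]
        exact one_le_two
      · have h2 : (fan A N).Adj (some ⟨j, hj⟩) (some i) := by
          rcases h with h | h | h
          · exact (hij h).elim
          · exact .inr h
          · exact .inl h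
        calc _ ≤ _ := SimpleGraph.edist_triangle (v := some ⟨j, hj⟩)
          _ = 2 := by rw [edist_eq_one_iff_adj.mpr h1, edist_eq_one_iff_adj.mpr h2]; rfl
  refine ediam_le_of_edist_le fun u v ↦ ?_
  calc _ ≤ _ := SimpleGraph.edist_triangle (v := none)
    _ ≤ 2 + 2 := add_le_add (edist_comm (G := fan A N) ▸ key u) (key v)
    _ = 4 := rfl

lemma lt_two_pow_of_fan_treedepth_le {c : ℕ} (h : (fan A N).treedepth ≤ c) : N < 2 ^ c := by
  classical
  refine lt_two_pow_of_treedepth_le h (fun i ↦ if hi : i < N then some ⟨i, hi⟩ else none)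
    (fun i hi ↦ ?_) fun i hi j hj hij ↦ ?_
  · rw [dif_pos (by omega : i < N), dif_pos hi]
    exact .inl rfl
  · simp only [Set.mem_Iio] at hi hj
    simpa [hi, hj] using hij

/-- An injective sequence of natural numbers with steps `1` and `-1` is monotone. -/
lemma eq_add_or_eq_add_of_injOn_of_step (h : ℕ → ℕ) (a b : ℕ)
    (hstep : ∀ i, a ≤ i → i + 1 ≤ b → h i + 1 = h (i + 1) ∨ h (i + 1) + 1 = h i)
    (hinj : Set.InjOn h (Set.Icc a b)) (hab : a ≤ b) :
    (∀ i, a ≤ i → i ≤ b → h i = h a + (i - a)) ∨ (∀ i, a ≤ i → i ≤ b → h a = h i + (i - a)) := by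
  induction b, hab using Nat.le_induction with
  | base =>
    refine .inl fun i h1 h2 ↦ ?_
    obtain rfl : i = a := by omega
    omega
  | succ b hab ih =>
    have hs := hstep b hab le_rfl
    rcases eq_or_lt_of_le hab with rfl | hlt
    · refine hs.imp (fun hs i h1 h2 ↦ ?_) (fun hs i h1 h2 ↦ ?_) <;>
      · obtain rfl | rfl : i = a ∨ i = a + 1 := by omega
        · omega
        · omega
    -- A change of direction would repeat a value.
    · have hne : h (b - 1) ≠ h (b + 1) := fun he ↦ by
        have := hinj (x₁ := b - 1) ⟨by omega, by omega⟩ (x₂ := b + 1) ⟨by omega, by omega⟩ he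
        omega
      refine (ih (fun i h1 h2 ↦ hstep i h1 (by omega))
        (hinj.mono (Set.Icc_subset_Icc_right (by omega)))).imp
          (fun ih i h1 h2 ↦ ?_) (fun ih i h1 h2 ↦ ?_) <;>
      · rcases Nat.lt_or_ge b i with hi | hi
        · obtain rfl : i = b + 1 := by omega
          have h3 := ih b hab le_rfl
          have h4 := ih (b - 1) (by omega) (by omega)
          omega
        · exact ih i h1 hi

/-- If no two elements of `A` differ by `m`, then the fan has no cycle of length `m + 2`. -/
lemma fan_isCycle_length_ne {m : ℕ} (hm : 1 ≤ m) (hA : ∀ x, A x → ¬ A (x + m))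
    {u : Option (Fin N)} (w : (fan A N).Walk u u) (hw : w.IsCycle) : w.length ≠ m + 2 := by
  classical
  intro hlen
  let pos : Option (Fin N) → ℕ := fun x ↦ x.elim 0 Fin.val
  have hpos_inj : ∀ x y, x ≠ none → y ≠ none → pos x = pos y → x = y := by
    rintro (_ | x) (_ | y) hx hy h
    · rfl
    · exact (hx rfl).elim
    · exact (hy rfl).elim
    · exact congrArg some (Fin.ext h)
  have hpos_adj : ∀ x y, x ≠ none → y ≠ none → (fan A N).Adj x y →
      pos x + 1 = pos y ∨ pos y + 1 = pos x := by
    rintro (_ | x) (_ | y) hx hy h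
    · exact (hx rfl).elim
    · exact (hx rfl).elim
    · exact (hy rfl).elim
    · exact h
  by_cases hnone : none ∈ w.support
  -- Started at the apex, the cycle traverses `m + 1` consecutive path vertices, whose two ends lie
  -- in `A` and differ by `m`.
  · obtain ⟨q, hq, hqlen⟩ : ∃ q : (fan A N).Walk none none, q.IsCycle ∧ q.length = m + 2 :=
      ⟨w.rotate none hnone, hw.rotate hnone, by rw [Walk.length_rotate, hlen]⟩
    have hinj := hq.getVert_injOn
    have hend : q.getVert (m + 2) = none := hqlen ▸ q.getVert_length
    have hne : ∀ i, 1 ≤ i → i ≤ m + 1 → q.getVert i ≠ none := by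
      intro i h1 h2 h
      have := hinj (x₁ := i) ⟨h1, by omega⟩ (x₂ := m + 2) ⟨by omega, by omega⟩ (h.trans hend.symm)
      omega
    have hcase := eq_add_or_eq_add_of_injOn_of_step (fun i ↦ pos (q.getVert i)) 1 (m + 1)
      (fun i h1 h2 ↦ hpos_adj _ _ (hne i h1 (by omega)) (hne (i + 1) (by omega) h2)
        (q.adj_getVert_succ (by omega)))
      (fun i hi j hj h ↦ hinj ⟨hi.1, by have := hi.2; omega⟩ ⟨hj.1, by have := hj.2; omega⟩
        (hpos_inj _ _ (hne i hi.1 hi.2) (hne j hj.1 hj.2) h)) (by omega)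
    have hA1 : A (pos (q.getVert 1)) := by
      have h1 := q.adj_getVert_succ (i := 0) (by omega)
      have h2 := hne 1 le_rfl (by omega)
      rw [q.getVert_zero] at h1
      revert h1 h2
      cases q.getVert 1 with
      | none => exact fun _ h ↦ (h rfl).elim
      | some i => exact fun h _ ↦ h
    have hA2 : A (pos (q.getVert (m + 1))) := by
      have h1 := q.adj_getVert_succ (i := m + 1) (by omega)
      have h2 := hne (m + 1) (by omega) le_rfl
      rw [hend] at h1
      revert h1 h2
      cases q.getVert (m + 1) with
      | none => exact fun _ h ↦ (h rfl).elim
      | some i => exact fun h _ ↦ h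
    rcases hcase with h | h
    · have := h (m + 1) (by omega) le_rfl
      simp only [Nat.add_sub_cancel] at this
      exact hA _ hA1 (this ▸ hA2)
    · have := h (m + 1) (by omega) le_rfl
      simp only [Nat.add_sub_cancel] at this
      exact hA _ hA2 (this ▸ hA1)
  -- Off the apex the positions are monotone, so the closing edge would join positions that differ
  -- by `m + 1 ≥ 2`.
  · have hne : ∀ i, w.getVert i ≠ none := fun i h ↦ hnone (h ▸ w.getVert_mem_support i)
    have hcase := eq_add_or_eq_add_of_injOn_of_step (fun i ↦ pos (w.getVert i)) 1 (m + 2)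
      (fun i h1 h2 ↦ hpos_adj _ _ (hne _) (hne _) (w.adj_getVert_succ (by omega)))
      (fun i hi j hj h ↦ hw.getVert_injOn ⟨hi.1, by have := hi.2; omega⟩
        ⟨hj.1, by have := hj.2; omega⟩ (hpos_inj _ _ (hne _) (hne _) h)) (by omega)
    have h1 := hpos_adj _ _ (hne _) (hne _) (w.adj_getVert_succ (i := 0) (by omega))
    have h2 : w.getVert (m + 2) = w.getVert 0 := by
      rw [← hlen, w.getVert_length, w.getVert_zero]
    rw [← h2, zero_add] at h1
    rcases hcase with h | h <;>
    · have := h (m + 2) (by omega) le_rfl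
      omega

/-- There is a set of natural numbers with gaps at most three and without two elements at
distance `m`. -/
lemma exists_dominating_of_no_difference {m : ℕ} (hm : 1 ≤ m) :
    ∃ A : ℕ → Prop, A 0 ∧ (∀ x, A x ∨ A (x + 1) ∨ A (x + 2)) ∧ ∀ x, A x → ¬ A (x + m) := by
  rcases Nat.even_or_odd m with he | ho
  -- Shifting by the even number `m` raises the quotient by one and flips the parity. A unit step
  -- flips it too unless `m ∣ x + 1`, which cannot happen twice in a row.
  · refine ⟨fun x ↦ Even (x + x / m), by simp, fun x ↦ ?_, fun x ↦ ?_⟩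
    · have hm2 : 2 ≤ m := by
        obtain ⟨k, hk⟩ := he
        omega
      have h1 : (x + 1) / m = x / m + if m ∣ x + 1 then 1 else 0 := Nat.succ_div
      have h2 : (x + 1 + 1) / m = (x + 1) / m + if m ∣ x + 1 + 1 then 1 else 0 :=
        Nat.succ_div
      have h3 : ¬ (m ∣ x + 1 ∧ m ∣ x + 1 + 1) := fun ⟨h, h'⟩ ↦ by
        have := Nat.le_of_dvd one_pos ((Nat.dvd_add_right h).mp h')
        omega
      change Even _ ∨ Even _ ∨ Even (x + 1 + 1 + (x + 1 + 1) / m)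
      rw [h2, h1]
      simp only [Nat.even_iff]
      split_ifs with h4 h5
      · exact (h3 ⟨h4, h5⟩).elim
      all_goals omega
    · have h1 : (x + m) / m = x / m + 1 := Nat.add_div_right x hm
      beta_reduce
      rw [h1]
      simp only [Nat.even_iff] at he ⊢
      omega
  · refine ⟨Even, by simp, fun x ↦ ?_, fun x ↦ ?_⟩
    · simp only [Nat.even_iff]
      omega
    · simp only [Nat.even_iff, Nat.odd_iff] at ho ⊢
      omega

/-- For every cycle length there are graphs of diameter at most four and large treedepth without
a cycle of that length. -/
lemma exists_fan_of_cycle_length {n : ℕ} (hn : 3 ≤ n) (c : ℕ) :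
    ∃ A N, (fan A N).ediam ≤ 4 ∧ ¬ (fan A N).treedepth ≤ c ∧ (cycleGraph n).Free (fan A N) := by
  obtain ⟨A, hA0, hA, hAm⟩ := exists_dominating_of_no_difference (m := n - 2) (by omega)
  -- Ending the path at an element of `A` keeps its last vertices dominated.
  obtain ⟨x, hx, hAx⟩ : ∃ x, 2 ^ c ≤ x ∧ A x := by
    rcases hA (2 ^ c) with h | h | h
    exacts [⟨_, le_rfl, h⟩, ⟨_, by omega, h⟩, ⟨_, by omega, h⟩]
  refine ⟨A, x + 1, fan_ediam_le fun i hi ↦ ?_, fun h ↦ ?_, fun h ↦ ?_⟩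
  · by_cases h0 : i = 0
    · exact ⟨0, by omega, hA0, .inl h0⟩
    by_cases hix : i = x
    · exact ⟨x, by omega, hAx, .inl hix⟩
    rcases hA (i - 1) with h | h | h
    · exact ⟨_, by omega, h, by omega⟩
    · exact ⟨_, by omega, h, by omega⟩
    · exact ⟨_, by omega, h, by omega⟩
  · have := lt_two_pow_of_fan_treedepth_le h
    omega
  · obtain ⟨u, w, hw, hlen⟩ := (cycleGraph_isContained_iff hn).mp h
    exact fan_isCycle_length_ne (by omega) hAm w hw (by omega)

/-- In a fan, every vertex of degree at least three is the apex or a neighbour of the apex. -/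
lemma eq_none_or_exists_adj_of_isContained_fan {W : Type*} {F : SimpleGraph W}
    (φ : Copy F (fan A N)) {a : W} (ha : 3 ≤ (F.neighborSet a).encard) :
    φ a = none ∨ ∃ w, F.Adj a w ∧ φ w = none := by
  obtain ⟨x, hx, y, hy, z, hz, hxy, hxz, hyz⟩ := exists_three_of_encard ha
  by_contra! h
  have hx' := φ.toHom.map_adj hx
  have hy' := φ.toHom.map_adj hy
  have hz' := φ.toHom.map_adj hz
  have hxy' := φ.injective.ne hxy
  have hxz' := φ.injective.ne hxz
  have hyz' := φ.injective.ne hyz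
  have h1 := h.2 x hx
  have h2 := h.2 y hy
  have h3 := h.2 z hz
  have h0 := h.1
  simp only [Copy.toHom_apply] at hx' hy' hz' hxy' hxz' hyz'
  obtain ⟨a', ha'⟩ := Option.ne_none_iff_exists'.mp h0
  obtain ⟨x', hx''⟩ := Option.ne_none_iff_exists'.mp h1
  obtain ⟨y', hy''⟩ := Option.ne_none_iff_exists'.mp h2
  obtain ⟨z', hz''⟩ := Option.ne_none_iff_exists'.mp h3
  rw [ha', hx''] at hx'
  rw [ha', hy''] at hy'
  rw [ha', hz''] at hz'
  rw [hx'', hy''] at hxy'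
  rw [hx'', hz''] at hxz'
  rw [hy'', hz''] at hyz'
  simp only [ne_eq, Option.some.injEq, Fin.ext_iff] at hxy' hxz' hyz'
  rcases hx' with h | h <;> rcases hy' with h' | h' <;> rcases hz' with h'' | h'' <;> omega

/-- In a fan, two vertices of degree at least three are adjacent or have a common neighbour. -/
lemma adj_or_exists_adj_of_isContained_fan {W : Type*} {F : SimpleGraph W}
    (hF : F ⊑ fan A N) {a b : W} (hab : a ≠ b) (ha : 3 ≤ (F.neighborSet a).encard)
    (hb : 3 ≤ (F.neighborSet b).encard) : F.Adj a b ∨ ∃ w, F.Adj a w ∧ F.Adj b w := by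
  obtain ⟨φ⟩ := hF
  have hinj : ∀ x y, φ x = none → φ y = none → x = y := fun x y hx hy ↦
    φ.injective (hx.trans hy.symm)
  rcases eq_none_or_exists_adj_of_isContained_fan φ ha with h1 | ⟨w, hw, h1⟩ <;>
    rcases eq_none_or_exists_adj_of_isContained_fan φ hb with h2 | ⟨w', hw', h2⟩
  · exact (hab (hinj _ _ h1 h2)).elim
  · exact .inl (hinj _ _ h1 h2 ▸ hw'.symm)
  · exact .inl (hinj _ _ h1 h2 ▸ hw)
  · exact .inr ⟨w, hw, hinj _ _ h1 h2 ▸ hw'⟩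

end Fan

/-- The graph obtained from the complete graph on `α` by subdividing every edge twice: the vertex
`i` of the complete graph is `(i, i)`, and the edge `ij` becomes the path through `(i, j)` and
`(j, i)`. -/
def subdividedComplete (α : Type*) : SimpleGraph (α × α) where
  Adj p q := p ≠ q ∧ (q = p.swap ∨ (p.1 = q.1 ∧ (p.1 = p.2 ∨ q.1 = q.2)))
  symm := ⟨by
    rintro p q ⟨hne, rfl | ⟨h1, h2⟩⟩
    · exact ⟨hne.symm, .inl p.swap_swap.symm⟩
    · exact ⟨hne.symm, .inr ⟨h1.symm, h2.symm⟩⟩⟩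
  loopless := ⟨fun _ h ↦ h.1 rfl⟩

section SubdividedComplete

variable {α : Type*}

/-- The route from `(i, j)` to `(k, l)` runs through `(i, i)`, `(i, k)`, `(k, i)`, `(k, k)`. This is
the construction that needs `5 ≤ d`. -/
lemma subdividedComplete_ediam_le : (subdividedComplete α).ediam ≤ 5 := by
  have h1 : ∀ i j : α, (subdividedComplete α).edist (i, i) (i, j) ≤ 1 := by
    intro i j
    by_cases h : i = j
    · simp [h]
    · refine (edist_eq_one_iff_adj.mpr ?_).le
      exact ⟨fun h' ↦ h (congrArg Prod.snd h'), .inr ⟨rfl, .inl rfl⟩⟩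
  have h2 : ∀ i j : α, (subdividedComplete α).edist (i, j) (j, i) ≤ 1 := by
    intro i j
    by_cases h : i = j
    · simp [h]
    · refine (edist_eq_one_iff_adj.mpr ?_).le
      exact ⟨fun h' ↦ h (congrArg Prod.fst h'), .inl rfl⟩
  have h3 : ∀ i j : α, (subdividedComplete α).edist (i, j) (i, i) ≤ 1 := fun i j ↦ by
    rw [edist_comm]
    exact h1 i j
  refine ediam_le_of_edist_le ?_
  rintro ⟨i, j⟩ ⟨k, l⟩
  calc _ ≤ _ := SimpleGraph.edist_triangle (v := (i, i))
    _ ≤ 1 + _ := add_le_add (h3 i j) (SimpleGraph.edist_triangle (v := (i, k)))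
    _ ≤ 1 + (1 + _) := add_le_add le_rfl
        (add_le_add (h1 i k) (SimpleGraph.edist_triangle (v := (k, i))))
    _ ≤ 1 + (1 + (1 + _)) := add_le_add le_rfl (add_le_add le_rfl
        (add_le_add (h2 i k) (SimpleGraph.edist_triangle (v := (k, k)))))
    _ ≤ 1 + (1 + (1 + (1 + 1))) := add_le_add le_rfl (add_le_add le_rfl
        (add_le_add le_rfl (add_le_add (h3 k i) (h1 k l))))
    _ = 5 := rfl

lemma lt_two_pow_of_subdividedComplete_treedepth_le {n c : ℕ}
    (h : (subdividedComplete (Fin (n + 1))).treedepth ≤ c) : n + 1 < 2 ^ c := by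
  let o : ℕ → Fin (n + 1) := Fin.ofNat (n + 1)
  have ho : ∀ i, i ≤ n → (o i).val = i := fun i hi ↦ Nat.mod_eq_of_lt (by omega)
  -- The subdivided path through `0, 1, 2, …`, with three vertices per step: `(s, s)`, `(s, s + 1)`,
  -- `(s + 1, s)`.
  let P : ℕ → Fin (n + 1) × Fin (n + 1) :=
    fun t ↦ (o ((t + 1) / 3), o ((t + 2) / 3 - if t % 3 = 2 then 1 else 0))
  have hP0 : ∀ s, P (3 * s) = (o s, o s) := fun s ↦ by
    simp only [P]
    rw [if_neg (by omega)]
    congr 2 <;> omega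
  have hP1 : ∀ s, P (3 * s + 1) = (o s, o (s + 1)) := fun s ↦ by
    simp only [P]
    rw [if_neg (by omega)]
    congr 2 <;> omega
  have hP2 : ∀ s, P (3 * s + 2) = (o (s + 1), o s) := fun s ↦ by
    simp only [P]
    rw [if_pos (by omega)]
    congr 2 <;> omega
  have hinj : Set.InjOn P (Set.Iio (n + 1)) := by
    intro t ht t' ht' h
    simp only [Set.mem_Iio] at ht ht'
    obtain ⟨h1, h2⟩ := Prod.ext_iff.mp h
    have h1 := congrArg Fin.val h1
    have h2 := congrArg Fin.val h2
    simp only [P] at h1 h2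
    rw [ho _ (by omega), ho _ (by omega)] at h1 h2
    split_ifs at h2 <;> omega
  refine lt_two_pow_of_treedepth_le h P (fun t ht ↦ ⟨fun h ↦ ?_, ?_⟩) hinj
  · have := hinj (show t < n + 1 by omega) ht h
    omega
  · obtain ⟨s, rfl | rfl | rfl⟩ : ∃ s, t = 3 * s ∨ t = 3 * s + 1 ∨ t = 3 * s + 2 :=
      ⟨t / 3, by omega⟩
    · rw [hP0, hP1]
      exact .inr ⟨rfl, .inl rfl⟩
    · rw [hP1, hP2]
      exact .inl rfl
    · rw [hP2, show 3 * s + 2 + 1 = 3 * (s + 1) by ring, hP0]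
      exact .inr ⟨rfl, .inr rfl⟩

/-- In the twice subdivided complete graph, the vertices of degree at least three are
the vertices of the complete graph. -/
lemma fst_eq_snd_of_isContained_subdividedComplete {W : Type*} {F : SimpleGraph W}
    (φ : Copy F (subdividedComplete α)) {a : W} (ha : 3 ≤ (F.neighborSet a).encard) :
    (φ a).1 = (φ a).2 := by
  obtain ⟨x, hx, y, hy, z, hz, hxy, hxz, hyz⟩ := exists_three_of_encard ha
  by_contra h
  have key : ∀ w, F.Adj a w → φ w = (φ a).swap ∨ φ w = ((φ a).1, (φ a).1) := by
    intro w hw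
    obtain ⟨_, h1 | ⟨h1, h2⟩⟩ := φ.toHom.map_adj hw
    · exact .inl h1
    · refine .inr (Prod.ext h1.symm ?_)
      exact (h2.resolve_left h).symm.trans h1.symm
  have hinj : ∀ {x y}, φ x = φ y → x = y := fun h ↦ φ.injective h
  rcases key x hx with h1 | h1 <;> rcases key y hy with h2 | h2 <;>
    rcases key z hz with h3 | h3
  all_goals first
    | exact hxy (hinj (h1.trans h2.symm))
    | exact hxz (hinj (h1.trans h3.symm))
    | exact hyz (hinj (h2.trans h3.symm))

/-- In the twice subdivided complete graph, two vertices of degree at least three are neither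
adjacent nor do they have a common neighbour. -/
lemma not_adj_or_exists_adj_of_isContained_subdividedComplete {W : Type*} {F : SimpleGraph W}
    (hF : F ⊑ subdividedComplete α) {a b : W} (hab : a ≠ b)
    (ha : 3 ≤ (F.neighborSet a).encard) (hb : 3 ≤ (F.neighborSet b).encard) :
    ¬ (F.Adj a b ∨ ∃ w, F.Adj a w ∧ F.Adj b w) := by
  obtain ⟨φ⟩ := hF
  have ha' := fst_eq_snd_of_isContained_subdividedComplete φ ha
  have hb' := fst_eq_snd_of_isContained_subdividedComplete φ hb
  have hne : φ a ≠ φ b := fun h ↦ hab (φ.injective h)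
  have hadj : ∀ x w, F.Adj x w → (φ x).1 = (φ x).2 → (φ x).1 = (φ w).1 := by
    intro x w hw hx
    obtain ⟨h0, h1 | ⟨h1, h2⟩⟩ := φ.toHom.map_adj hw
    · have h2 : φ w = (φ x).swap := h1
      rw [h2, Prod.fst_swap, hx]
    · exact h1
  have hfst : (φ a).1 ≠ (φ b).1 := fun h ↦ hne (Prod.ext h (by rw [← ha', ← hb', h]))
  rintro (h | ⟨w, h1, h2⟩)
  · exact hfst (hadj a b h ha')
  · exact hfst ((hadj a w h1 ha').trans (hadj b w h2 hb').symm)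

end SubdividedComplete

/-- A graph with a level function in which every edge joins a vertex to its parent is acyclic. -/
lemma isAcyclic_of_parent {V : Type*} {G : SimpleGraph V} (f : V → V) (L : V → ℕ)
    (h : ∀ u w, G.Adj u w → L w < L u ∧ f u = w ∨ L u < L w ∧ f w = u) : G.IsAcyclic := by
  classical
  intro u w hw
  -- At a vertex of the cycle of maximal level both cycle neighbours would be its parent.
  obtain ⟨x, hx, hmax⟩ := Finset.exists_max_image w.support.toFinset L ⟨u, by simp⟩
  rw [List.mem_toFinset] at hx
  set q := w.rotate x hx
  have hqc : q.IsCycle := hw.rotate hx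
  have hqs : ∀ i, L (q.getVert i) ≤ L x := fun i ↦ hmax _ (by
    rw [List.mem_toFinset]
    exact (w.mem_support_rotate_iff x hx).mp (q.getVert_mem_support i))
  have hlen := hqc.three_le_length
  have h1 : f x = q.getVert 1 := by
    have := q.adj_getVert_succ (i := 0) (by omega)
    rw [q.getVert_zero, zero_add] at this
    have h2 := hqs 1
    rcases h _ _ this with h | h
    · exact h.2
    · omega
  have h2 : f x = q.getVert (q.length - 1) := by
    have := q.adj_getVert_succ (i := q.length - 1) (by omega)
    rw [Nat.sub_add_cancel (by omega), q.getVert_length] at this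
    have h2 := hqs (q.length - 1)
    rcases h _ _ this with h | h
    · omega
    · exact h.2
  have := hqc.getVert_injOn (x₁ := 1) ⟨le_rfl, by omega⟩ (x₂ := q.length - 1)
    ⟨by omega, by omega⟩ (h1.symm.trans h2)
  omega

/-- The spider with `k` legs of `l + 1` vertices each. -/
def spider (k l : ℕ) : SimpleGraph (Option (Fin k × Fin (l + 1))) where
  Adj
    | none, none => False
    | none, some p => p.2.1 = 0
    | some p, none => p.2.1 = 0
    | some p, some q => p.1 = q.1 ∧ (p.2.1 + 1 = q.2.1 ∨ q.2.1 + 1 = p.2.1)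
  symm := ⟨by
    rintro (_ | p) (_ | q) h
    · exact h
    · exact h
    · exact h
    · exact ⟨h.1.symm, h.2.symm⟩⟩
  loopless := ⟨by
    rintro (_ | p) h
    · exact h
    · rcases h.2 with h | h <;> omega⟩

lemma spider_hasSpider (k l : ℕ) : (spider k l).HasSpider k (l + 1) := by
  refine ⟨none, fun i t ↦ some (i, Fin.ofNat (l + 1) t), fun i _ ↦ ?_, fun i t ht ↦ ?_,
    fun i t _ ↦ by simp, fun i t j s ht hs h ↦ ?_⟩
  · exact Nat.zero_mod _
  · refine ⟨rfl, .inl ?_⟩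
    simp only [Fin.val_ofNat]
    rw [Nat.mod_eq_of_lt ht, Nat.mod_eq_of_lt (by omega)]
  · simp only [Option.some.injEq, Prod.mk.injEq, Fin.ext_iff, Fin.val_ofNat] at h
    rw [Nat.mod_eq_of_lt ht, Nat.mod_eq_of_lt hs] at h
    exact ⟨Fin.ext h.1, h.2⟩

lemma spider_isSubdividedStar {k : ℕ} (hk : 3 ≤ k) (l : ℕ) :
    (spider k l).IsSubdividedStar := by
  have hreach : ∀ u, (spider k l).Reachable none u := by
    rintro (_ | ⟨i, t, ht⟩)
    · rfl
    · induction t with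
      | zero => exact Adj.reachable (show (spider k l).Adj none (some (i, ⟨0, ht⟩)) from rfl)
      | succ t ih =>
        refine (ih (by omega)).trans (Adj.reachable ?_)
        exact ⟨rfl, .inl rfl⟩
  refine ⟨⟨⟨fun u v ↦ (hreach u).symm.trans (hreach v)⟩, ?_⟩, none, ?_, ?_⟩
  · refine isAcyclic_of_parent (fun u ↦ u.elim none fun p ↦
        if p.2.1 = 0 then none else some (p.1, ⟨p.2.1 - 1, by omega⟩))
      (fun u ↦ u.elim 0 fun p ↦ p.2.1 + 1) ?_
    rintro (_ | p) (_ | q) h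
    · exact h.elim
    · refine .inr ⟨Nat.succ_pos _, ?_⟩
      exact if_pos h
    · refine .inl ⟨Nat.succ_pos _, ?_⟩
      exact if_pos h
    · obtain ⟨h1, h2⟩ := h
      refine h2.symm.imp (fun h ↦ ⟨?_, ?_⟩) (fun h ↦ ⟨?_, ?_⟩)
      · simp only [Option.elim_some]
        omega
      · simp only [Option.elim_some]
        rw [if_neg (by omega)]
        refine congrArg some (Prod.ext h1 (Fin.ext ?_))
        change p.2.1 - 1 = q.2.1
        omega
      · simp only [Option.elim_some]
        omega
      · simp only [Option.elim_some]
        rw [if_neg (by omega)]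
        refine congrArg some (Prod.ext h1.symm (Fin.ext ?_))
        change q.2.1 - 1 = p.2.1
        omega
  · have hsub : Set.range (fun i : Fin k ↦ (some (i, 0) : Option (Fin k × Fin (l + 1)))) ⊆
        (spider k l).neighborSet none := by
      rintro _ ⟨i, rfl⟩
      exact (rfl : ((0 : Fin (l + 1)) : ℕ) = 0)
    refine le_trans ?_ (Set.encard_le_encard hsub)
    rw [← Set.image_univ, Function.Injective.encard_image (fun i j h ↦ by simpa using h),
      Set.encard_univ]
    simpa using hk
  · rintro (_ | p) hp
    · rfl
    · obtain ⟨x, hx, y, hy, z, hz, hxy, hxz, hyz⟩ := exists_three_of_encard hp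
      exfalso
      let pos : Option (Fin k × Fin (l + 1)) → ℕ := fun u ↦ u.elim 0 fun q ↦ q.2.1 + 1
      have hpos : ∀ w, (spider k l).Adj (some p) w → pos w = p.2.1 ∨ pos w = p.2.1 + 2 := by
        rintro (_ | q) h
        · exact .inl (Eq.symm h)
        · refine h.2.symm.imp (fun h ↦ h) (fun h ↦ ?_)
          simp only [pos, Option.elim_some]
          omega
      have hpos_inj : ∀ w w', (spider k l).Adj (some p) w → (spider k l).Adj (some p) w' →
          pos w = pos w' → w = w' := by
        rintro (_ | q) (_ | q') h h' heq
        · rfl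
        · exact (Nat.succ_ne_zero _ heq.symm).elim
        · exact (Nat.succ_ne_zero _ heq).elim
        · exact congrArg some (Prod.ext (h.1.symm.trans h'.1) (Fin.ext (Nat.succ_injective heq)))
      have h1 := mt (hpos_inj x y hx hy) hxy
      have h2 := mt (hpos_inj x z hx hz) hxz
      have h3 := mt (hpos_inj y z hy hz) hyz
      have h4 := hpos x hx
      have h5 := hpos y hy
      have h6 := hpos z hz
      omega

end Constructions

/-! ### The two directions -/

/-- A graph that is contained in all graphs of diameter at most five and large treedepth is
acyclic and has at most one vertex of degree at least three. -/
lemma isAcyclic_and_subsingleton_of_treedepth_le {W : Type*} {F : SimpleGraph W} {c : ℕ}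
    (h : ∀ (V : Type) [Finite V] (G : SimpleGraph V), F.Free G → G.ediam ≤ 5 → G.treedepth ≤ c) :
    F.IsAcyclic ∧ ∀ a b, 3 ≤ (F.neighborSet a).encard → 3 ≤ (F.neighborSet b).encard → a = b := by
  refine ⟨isAcyclic_iff_free_cycleGraph.mpr fun n hn hF ↦ ?_, fun a b ha hb ↦ ?_⟩
  · obtain ⟨A, N, h1, h2, h3⟩ := exists_fan_of_cycle_length hn c
    exact h2 (h _ _ (fun h' ↦ h3 (hF.trans h')) (h1.trans (by norm_num)))
  · by_contra hab
    have h1 : F ⊑ fan (fun _ ↦ True) (2 ^ c) := by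
      by_contra hF
      have := lt_two_pow_of_fan_treedepth_le (h _ _ hF
        ((fan_ediam_le fun i hi ↦ ⟨i, hi, trivial, .inl rfl⟩).trans (by norm_num)))
      omega
    have h2 : F ⊑ subdividedComplete (Fin (2 ^ c + 1)) := by
      by_contra hF
      have := lt_two_pow_of_subdividedComplete_treedepth_le (h _ _ hF subdividedComplete_ediam_le)
      omega
    exact not_adj_or_exists_adj_of_isContained_subdividedComplete h2 hab ha hb
      (adj_or_exists_adj_of_isContained_fan h1 hab ha hb)

/-- A finite acyclic graph with at most one vertex of degree at least three is contained in a
subdivided star. -/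
lemma IsAcyclic.exists_isSubdividedStar {W : Type*} [Finite W] {F : SimpleGraph W}
    (hF : F.IsAcyclic)
    (h : ∀ a b, 3 ≤ (F.neighborSet a).encard → 3 ≤ (F.neighborSet b).encard → a = b) :
    ∃ (U : Type) (_ : Finite U) (S : SimpleGraph U), S.IsSubdividedStar ∧ F ⊑ S := by
  -- The added `3` ensures a centre of degree at least three, even for small `W`.
  refine ⟨_, inferInstance, spider (Nat.card W + 3) (Nat.card W),
    spider_isSubdividedStar (by omega) _, ?_⟩
  rcases isEmpty_or_nonempty W with hW | ⟨⟨w⟩⟩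
  · exact .of_isEmpty
  obtain ⟨v, hv⟩ : ∃ v, ∀ u, u ≠ v → ¬ 3 ≤ (F.neighborSet u).encard := by
    by_cases hex : ∃ v, 3 ≤ (F.neighborSet v).encard
    · obtain ⟨v, hv⟩ := hex
      exact ⟨v, fun u hu h' ↦ hu (h _ _ h' hv)⟩
    · exact ⟨w, fun u _ h' ↦ hex ⟨u, h'⟩⟩
  exact hF.isContained_of_hasSpider v hv (by omega) (by omega) (spider_hasSpider _ _)

/-- Graphs of bounded diameter without a fixed subdivided star have bounded treedepth. -/
lemma IsSubdividedStar.exists_treedepth_le {U : Type*} [Finite U] {S : SimpleGraph U}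
    (hS : S.IsSubdividedStar) (d : ℕ) :
    ∃ c : ℕ, ∀ (V : Type) [Finite V] (G : SimpleGraph V),
      S.Free G → G.ediam ≤ d → G.treedepth ≤ c := by
  obtain ⟨htree, v, -, hv⟩ := hS
  have hcard : 0 < Nat.card U := Nat.card_pos_iff.mpr ⟨⟨v⟩, inferInstance⟩
  set k := Nat.card U with hk
  refine ⟨2 * k * (branchBound (2 * k * (k + 1)) d + 1), fun V _ G hfree hd ↦ ?_⟩
  have hpre : G.Preconnected :=
    preconnected_of_ediam_ne_top (ne_top_of_le_ne_top (ENat.natCast_ne_top d) hd)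
  refine treedepth_le_of_no_path hpre fun l hchain hnodup ↦ ?_
  by_contra! hlen
  have hl0 : 0 < l.length := by omega
  have : Nonempty V := ⟨l[0]⟩
  have hconn : G.Connected := ⟨hpre⟩
  refine hfree (htree.isAcyclic.isContained_of_hasSpider v (fun u hu h ↦ hu (hv u h))
    le_rfl le_rfl (hasSpider_of_path hconn (d := d) l[0] (fun u ↦ ?_) k k hcard
      (fun i ↦ l.getD i l[0]) (fun i hi ↦ ?_) fun i hi j hj hij ↦ ?_))
  · have h1 := (edist_le_ediam (G := G) (u := l[0]) (v := u)).trans hd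
    rw [← (hconn l[0] u).coe_dist_eq_edist] at h1
    exact_mod_cast h1
  · rw [List.getD_eq_getElem _ _ (by omega), List.getD_eq_getElem _ _ (by omega)]
    exact List.isChain_iff_getElem.mp hchain i (by omega)
  · simp only [Set.mem_Iio] at hi hj
    beta_reduce at hij
    rw [List.getD_eq_getElem _ _ (by omega), List.getD_eq_getElem _ _ (by omega)] at hij
    exact hnodup.getElem_inj_iff.mp hij

end SimpleGraph

theorem theorem1 (d : ℕ) (hd : 5 ≤ d) {W : Type*} [Finite W] (F : SimpleGraph W) :
    (∃ c : ℕ, ∀ (V : Type) [Finite V] (G : SimpleGraph V),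
        F.Free G → G.ediam ≤ d → G.treedepth ≤ c) ↔
      ∃ (U : Type) (_ : Finite U) (S : SimpleGraph U),
        S.IsSubdividedStar ∧ F.IsContained S := by
  constructor
  · rintro ⟨c, hc⟩
    obtain ⟨h1, h2⟩ := SimpleGraph.isAcyclic_and_subsingleton_of_treedepth_le (F := F) (c := c)
      fun V _ G hF hG ↦ hc V G hF (hG.trans (by exact_mod_cast hd))
    exact h1.exists_isSubdividedStar h2
  · rintro ⟨U, _, S, hS, hFS⟩
    obtain ⟨c, hc⟩ := hS.exists_treedepth_le d
    exact ⟨c, fun V _ G hF hG ↦ hc V G (fun h ↦ hF (hFS.trans h)) hG⟩
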